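/- Let $V$ be a semicartesian monoidal category (its unit object is terminal). Let $W$ be a closed symmetric monoidal model category with cofibrant unit object $I$ satisfying the pushout-product axiom (for instance a symmetric monoidal simplicial model category). Let $\Bbbk$ be a commutative ring, and let $\chi$ be a multiplicative Euler characteristic on $W$ with values in $\Bbbk$: a partial function on the objects of $W$ (the objects of its domain are called finite) such that (i) weakly equivalent objects are simultaneously finite and have the same $\chi$; (ii) the initial object is finite with $\chi(\emptyset)=0$; (iii) the homotopy pushout $P$ of a span $B\leftarrow A\to C$ of finite objects is finite, with $\chi(P)=\chi(B)+\chi(C)-\chi(A)$; (iv) $I$ is finite with $\chi(I)=1$; (v) if $A,B$ are finite and cofibrant, then $A\otimes B$ is finite and $\chi(A\otimes B)=\chi(A)\chi(B)$. Let $\Sigma:V\to W$ be a strong monoidal functor with finite values, and put $\#=\chi\circ\Sigma$. Let $X$ be a $V$-category with finitely many objects such that the $W$-category $\Sigma X$, with hom-objects $\Sigma(X(x,y))$, is cofibrant: all $\Sigma(X(x,y))$ are cofibrant and all identity-assigning maps $I\to\Sigma(X(x,x))$ are cofibrations. Suppose that $X$ has Möbius inversion, i.e. that the matrix $Z_X=(\#X(x,y))_{x,y}$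 is invertible over $\Bbbk$. The magnitude of $X$ is the sum of all entries of $Z_X^{-1}$. For objects $x_0,\dots,x_n$ of $X$ let $$B_{x_0,\dots,x_n}=\Sigma X(x_0,x_1)\otimes\cdots\otimes\Sigma X(x_{n-1},x_n)\otimes\Sigma(1),$$ where $1$ is the unit object of $V$. A degeneracy operator $(y_0,\dots,y_k)\to(x_0,\dots,x_n)$ is a monotone surjection $\sigma:\{0,\dots,n\}\to\{0,\dots,k\}$ with $x_i=y_{\sigma(i)}$ for all $i$; it induces a map $B_{y_0,\dots,y_k}\to B_{x_0,\dots,x_n}$ inserting identities of $\Sigma X$. Let $L_{x_0,\dots,x_n}$ be the latching object, i.e. the colimit of the objects $B_{y_0,\dots,y_k}$ over all degeneracy operators $(y_0,\dots,y_k)\to(x_0,\dots,x_n)$ with $k<n$. Then all $B_{x_0,\dots,x_n}$ and $L_{x_0,\dots,x_n}$ are finite, so that $$\mathrm{wgt}(x_0,\dots,x_n)=\chi(B_{x_0,\dots,x_n})-\chi(L_{x_0,\dots,x_n})$$ is defined, and the formal power series $$F(t)=\sum_{n\ge 0}t^n\sum_{x_0,\dots,x_n}\mathrm{wgt}(x_0,\dots,x_n)\in\Bbbk[[t]]$$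 is a rational function whose value at $t=-1$ is defined and is the magnitude of $X$. That is, there are polynomials $P,Q\in\Bbbk[t]$, with $Q$ invertible in $\Bbbk[[t]]$ and $Q(-1)$ invertible in $\Bbbk$, such that $QF=P$ in $\Bbbk[[t]]$ and $P(-1)/Q(-1)$ is the magnitude of $X$. (If $\Bbbk$ is a field, this says that the image of $F$ in $\Bbbk((t))$ is the image of an element of $\Bbbk(t)$ which is defined at $t=-1$ and whose value there is the magnitude of $X$.) -/

import Mathlib

open CategoryTheory MonoidalCategory Limits HomotopicalAlgebra

universe w v v₁ v₂ u u₁ u₂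

/-! ### Magnitude of an enriched category -/

section Magnitude

/-- The zeta function of a `V`-category `X` with finitely many objects, with respect to
`size : ob V → k`, as a matrix. -/
def zetaMatrix {V : Type u₁} [Category.{v₁} V] [MonoidalCategory V] {k : Type u}
    (size : V → k) (X : Type w) [EnrichedCategory V X] : Matrix X X k :=
  Matrix.of fun x y => size (x ⟶[V] y)

/-- `X` has Möbius inversion: its zeta matrix is invertible over `k`. -/
def HasMobiusInversion {V : Type u₁} [Category.{v₁} V] [MonoidalCategory V] {k : Type u}
    [CommRing k] (size : V → k) (X : Type w) [EnrichedCategory V X] [Fintype X]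
    [DecidableEq X] : Prop :=
  IsUnit (zetaMatrix size X)

/-- The magnitude of `X`: the sum of all entries of the inverse of the zeta matrix
(meaningful when `X` has Möbius inversion). -/
noncomputable def magnitude {V : Type u₁} [Category.{v₁} V] [MonoidalCategory V] {k : Type u}
    [CommRing k] (size : V → k) (X : Type w) [EnrichedCategory V X] [Fintype X]
    [DecidableEq X] : k :=
  ∑ x : X, ∑ y : X, (zetaMatrix size X)⁻¹ x y

end Magnitude

/-! ### Monoidal model categories, homotopy pushouts, Euler characteristics -/

section EulerCharacteristic

variable (W : Type u₂) [Category.{v₂} W] [ModelCategory W]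

/-- The compatibility of a monoidal structure with a model structure: the unit object is
cofibrant and the pushout-product axiom holds. (The pushout product of `f : A ⟶ B` and
`g : K ⟶ L` is the map `ι` from the pushout of `f ▷ K` and `A ◁ g` to `B ⊗ L`.) -/
class IsMonoidalModelCategory [MonoidalCategory W] : Prop where
  isCofibrant_unit : IsCofibrant (𝟙_ W)
  cofibration_ι {A B K L : W} (f : A ⟶ B) (g : K ⟶ L)
    (sq : (curriedTensor W).PushoutObjObj f g) :
    Cofibration f → Cofibration g → Cofibration sq.ι
  weakEquivalence_ι_left {A B K L : W} (f : A ⟶ B) (g : K ⟶ L)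
    (sq : (curriedTensor W).PushoutObjObj f g) :
    Cofibration f → Cofibration g → WeakEquivalence f → WeakEquivalence sq.ι
  weakEquivalence_ι_right {A B K L : W} (f : A ⟶ B) (g : K ⟶ L)
    (sq : (curriedTensor W).PushoutObjObj f g) :
    Cofibration f → Cofibration g → WeakEquivalence g → WeakEquivalence sq.ι

variable {W}

/-- `P` is a homotopy pushout of the span `B ⟵ A ⟶ C`: it is the pushout of a span
`B' ⟵ A' ⟶ C'` of two cofibrations with cofibrant source which is weakly equivalent to the
given span. (It is well defined up to weak equivalence.) -/
def IsHomotopyPushout {A B C : W} (f : A ⟶ B) (g : A ⟶ C) (P : W) : Prop :=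
  ∃ (A' B' C' : W) (f' : A' ⟶ B') (g' : A' ⟶ C') (a : A' ⟶ A) (b : B' ⟶ B) (c : C' ⟶ C)
    (inl : B' ⟶ P) (inr : C' ⟶ P),
    IsCofibrant A' ∧ Cofibration f' ∧ Cofibration g' ∧
    WeakEquivalence a ∧ WeakEquivalence b ∧ WeakEquivalence c ∧
    f' ≫ b = a ≫ f ∧ g' ≫ c = a ≫ g ∧ IsPushout f' g' inl inr

variable (W)

/-- An Euler characteristic on a model category, with values in an abelian group: a partial
function on objects, with domain the objects satisfying `IsFinite`. It is represented by
a function `chi` whose values on other objects are arbitrary. -/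
structure EulerCharacteristic (k : Type u) [AddCommGroup k] where
  IsFinite : W → Prop
  chi : W → k
  isFinite_iff_of_weakEquivalence {A B : W} (f : A ⟶ B) :
    WeakEquivalence f → (IsFinite A ↔ IsFinite B)
  chi_eq_of_weakEquivalence {A B : W} (f : A ⟶ B) :
    WeakEquivalence f → IsFinite A → chi A = chi B
  isFinite_initial : IsFinite (⊥_ W)
  chi_initial : chi (⊥_ W) = 0
  isFinite_homotopyPushout {A B C : W} (f : A ⟶ B) (g : A ⟶ C) (P : W) :
    IsFinite A → IsFinite B → IsFinite C → IsHomotopyPushout f g P → IsFinite P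
  chi_homotopyPushout {A B C : W} (f : A ⟶ B) (g : A ⟶ C) (P : W) :
    IsFinite A → IsFinite B → IsFinite C → IsHomotopyPushout f g P →
      chi P = chi B + chi C - chi A

variable {W}

/-- An Euler characteristic with values in a ring, on a monoidal model category, is
multiplicative. -/
structure EulerCharacteristic.IsMultiplicative [MonoidalCategory W] {k : Type u} [CommRing k]
    (χ : EulerCharacteristic W k) : Prop where
  isFinite_unit : χ.IsFinite (𝟙_ W)
  chi_unit : χ.chi (𝟙_ W) = 1
  isFinite_tensor (A B : W) : χ.IsFinite A → χ.IsFinite B → IsCofibrant A → IsCofibrant B →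
    χ.IsFinite (A ⊗ B)
  chi_tensor (A B : W) : χ.IsFinite A → χ.IsFinite B → IsCofibrant A → IsCofibrant B →
    χ.chi (A ⊗ B) = χ.chi A * χ.chi B

/-- The size `χ ∘ Σ` on `V` induced by `χ` and a functor `Σ : V ⥤ W`. -/
def EulerCharacteristic.size {k : Type u} [AddCommGroup k] (χ : EulerCharacteristic W k)
    {V : Type u₁} [Category.{v₁} V] (S : V ⥤ W) : V → k :=
  fun a => χ.chi (S.obj a)

/-- A `W`-category is cofibrant if all its hom-objects are cofibrant and all the
identity-assigning maps `𝟙_ W ⟶ Y(y, y)` are cofibrations. -/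
def IsCofibrantEnriched (W : Type u₂) [Category.{v₂} W] [ModelCategory W] [MonoidalCategory W]
    (Y : Type w) [EnrichedCategory W Y] : Prop :=
  (∀ y y' : Y, IsCofibrant (y ⟶[W] y')) ∧ ∀ y : Y, Cofibration (eId W y)

end EulerCharacteristic

/-! ### Bimodules, and the bimodule constant at the unit -/

section Bimodule

/-- A `Y`-`Y`-bimodule (a `W`-functor `Yᵒᵖ ⊗ Y ⟶ W`, given by its two actions), contravariant in the first and covariant in the second variable. -/
structure EnrichedBimodule (W : Type u₂) [Category.{v₂} W] [MonoidalCategory W] (Y : Type w)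
    [EnrichedCategory W Y] where
  obj : Y → Y → W
  actL (x y z : Y) : (x ⟶[W] y) ⊗ obj y z ⟶ obj x z
  actR (x y z : Y) : obj x y ⊗ (y ⟶[W] z) ⟶ obj x z
  id_actL (x y : Y) : (λ_ (obj x y)).inv ≫ eId W x ▷ obj x y ≫ actL x x y = 𝟙 _
  actR_id (x y : Y) : (ρ_ (obj x y)).inv ≫ obj x y ◁ eId W y ≫ actR x y y = 𝟙 _
  actL_actL (x y z t : Y) :
    (α_ (x ⟶[W] y) (y ⟶[W] z) (obj z t)).inv ≫ eComp W x y z ▷ obj z t ≫ actL x z t =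
      (x ⟶[W] y) ◁ actL y z t ≫ actL x y t
  actR_actR (x y z t : Y) :
    (α_ (obj x y) (y ⟶[W] z) (z ⟶[W] t)).inv ≫ actR x y z ▷ (z ⟶[W] t) ≫ actR x z t =
      obj x y ◁ eComp W y z t ≫ actR x y t
  actL_actR (x y z t : Y) :
    (α_ (x ⟶[W] y) (obj y z) (z ⟶[W] t)).inv ≫ actL x y z ▷ (z ⟶[W] t) ≫ actR x z t =
      (x ⟶[W] y) ◁ actR y z t ≫ actL x y t

variable {V : Type u₁} [Category.{v₁} V] [SemiCartesianMonoidalCategory V]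
  {W : Type u₂} [Category.{v₂} W] [MonoidalCategory W]

section

open Functor.LaxMonoidal SemiCartesianMonoidalCategory

variable (S : V ⥤ W) [S.LaxMonoidal]

lemma unitBimodule_id_actL {A : V} (e : 𝟙_ V ⟶ A) :
    (λ_ (S.obj (𝟙_ V))).inv ≫ (ε S ≫ S.map e) ▷ S.obj (𝟙_ V) ≫ μ S A (𝟙_ V) ≫
      S.map (toUnit _) = 𝟙 _ := by
  simp only [comp_whiskerRight, Category.assoc, μ_natural_left_assoc, left_unitality_inv_assoc,
    ← S.map_comp]
  rw [← S.map_id]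
  congr 1
  exact toUnit_unique _ _

lemma unitBimodule_actR_id {A : V} (e : 𝟙_ V ⟶ A) :
    (ρ_ (S.obj (𝟙_ V))).inv ≫ S.obj (𝟙_ V) ◁ (ε S ≫ S.map e) ≫ μ S (𝟙_ V) A ≫
      S.map (toUnit _) = 𝟙 _ := by
  simp only [MonoidalCategory.whiskerLeft_comp, Category.assoc, μ_natural_right_assoc,
    right_unitality_inv_assoc, ← S.map_comp]
  rw [← S.map_id]
  congr 1
  exact toUnit_unique _ _

lemma unitBimodule_actL_actL {A B C : V} (m : A ⊗ B ⟶ C) :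
    (α_ (S.obj A) (S.obj B) (S.obj (𝟙_ V))).inv ≫ (μ S A B ≫ S.map m) ▷ S.obj (𝟙_ V) ≫
        μ S C (𝟙_ V) ≫ S.map (toUnit _) =
      S.obj A ◁ (μ S B (𝟙_ V) ≫ S.map (toUnit _)) ≫ μ S A (𝟙_ V) ≫ S.map (toUnit _) := by
  simp only [comp_whiskerRight, MonoidalCategory.whiskerLeft_comp, Category.assoc,
    μ_natural_left_assoc, μ_natural_right_assoc, ← associativity_inv_assoc, ← S.map_comp]
  congr 3
  exact toUnit_unique _ _

lemma unitBimodule_actR_actR {A B C : V} (m : A ⊗ B ⟶ C) :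
    (α_ (S.obj (𝟙_ V)) (S.obj A) (S.obj B)).inv ≫ (μ S (𝟙_ V) A ≫ S.map (toUnit _)) ▷ S.obj B ≫
        μ S (𝟙_ V) B ≫ S.map (toUnit _) =
      S.obj (𝟙_ V) ◁ (μ S A B ≫ S.map m) ≫ μ S (𝟙_ V) C ≫ S.map (toUnit _) := by
  simp only [comp_whiskerRight, MonoidalCategory.whiskerLeft_comp, Category.assoc,
    μ_natural_left_assoc, μ_natural_right_assoc, ← associativity_inv_assoc, ← S.map_comp]
  congr 3
  exact toUnit_unique _ _

lemma unitBimodule_actL_actR (A B : V) :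
    (α_ (S.obj A) (S.obj (𝟙_ V)) (S.obj B)).inv ≫ (μ S A (𝟙_ V) ≫ S.map (toUnit _)) ▷ S.obj B ≫
        μ S (𝟙_ V) B ≫ S.map (toUnit _) =
      S.obj A ◁ (μ S (𝟙_ V) B ≫ S.map (toUnit _)) ≫ μ S A (𝟙_ V) ≫ S.map (toUnit _) := by
  simp only [comp_whiskerRight, MonoidalCategory.whiskerLeft_comp, Category.assoc,
    μ_natural_left_assoc, μ_natural_right_assoc, ← associativity_inv_assoc, ← S.map_comp]
  congr 3
  exact toUnit_unique _ _

end

open Functor.LaxMonoidal SemiCartesianMonoidalCategory in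
/-- The bimodule over `Σ X` obtained by applying `Σ` to the diagram constant at the unit
object of `V`, which is terminal. -/
def unitBimodule (S : V ⥤ W) [S.Monoidal] (X : Type w) [EnrichedCategory V X] :
    EnrichedBimodule W (TransportEnrichment S X) where
  obj _ _ := S.obj (𝟙_ V)
  actL x y _ := μ S (EnrichedCategory.Hom (V := V) (C := X) x y) (𝟙_ V) ≫ S.map (toUnit _)
  actR _ y z := μ S (𝟙_ V) (EnrichedCategory.Hom (V := V) (C := X) y z) ≫ S.map (toUnit _)
  id_actL x _ := unitBimodule_id_actL S (eId V (C := X) x)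
  actR_id _ y := unitBimodule_actR_id S (eId V (C := X) y)
  actL_actL x y z _ := unitBimodule_actL_actL S (eComp V (C := X) x y z)
  actR_actR _ y z t := unitBimodule_actR_actR S (eComp V (C := X) y z t)
  actL_actR _ _ _ _ := unitBimodule_actL_actR S _ _

end Bimodule

/-! ### Degeneracies, the summands of the bar construction and their latching objects -/

section Bar

/-- Nonempty lists `x₀, …, xₙ` in `Y` are written as a head `x₀` and a tail. An element of
`Degeneracy x l' l` is a degeneracy operator from `x :: l' = (y₀, …, y_k)` to
`x :: l = (x₀, …, xₙ)`, i.e. a monotone surjection `σ : {0, …, n} → {0, …, k}` with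
`x_i = y_{σ i}`: `keep` is the case `σ 0 < σ 1`, and `dup` is the case `σ 0 = σ 1`. -/
inductive Degeneracy {Y : Type w} : Y → List Y → List Y → Type w
  | nil (x : Y) : Degeneracy x [] []
  | keep (x : Y) {y : Y} {l' l : List Y} (f : Degeneracy y l' l) :
      Degeneracy x (y :: l') (y :: l)
  | dup {x : Y} {l' l : List Y} (f : Degeneracy x l' l) : Degeneracy x l' (x :: l)

namespace Degeneracy

variable {Y : Type w}

/-- The identity degeneracy operator. -/
def id : (x : Y) → (l : List Y) → Degeneracy x l l
  | x, [] => nil x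
  | x, y :: l => keep x (id y l)

/-- Composition of degeneracy operators. -/
def comp : {x : Y} → {l₁ l₂ l₃ : List Y} →
    Degeneracy x l₁ l₂ → Degeneracy x l₂ l₃ → Degeneracy x l₁ l₃
  | _, _, _, _, f, nil _ => f
  | _, _, _, _, f, dup g => dup (comp f g)
  | _, _, _, _, keep x f, keep _ g => keep x (comp f g)
  | _, _, _, _, dup f, keep _ g => dup (comp f g)

lemma id_comp {x : Y} {l₁ l₂ : List Y} (f : Degeneracy x l₁ l₂) : comp (id x l₁) f = f := by
  induction f with
  | nil x => rfl
  | keep x f ih => simp [id, comp, ih]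
  | dup f ih => simp [comp, ih]

lemma comp_id {x : Y} {l₁ l₂ : List Y} (f : Degeneracy x l₁ l₂) : comp f (id x l₂) = f := by
  induction f with
  | nil x => rfl
  | keep x f ih => simp [id, comp, ih]
  | dup f ih => simp [id, comp, ih]

lemma comp_assoc {x : Y} {l₁ l₂ l₃ l₄ : List Y} (f : Degeneracy x l₁ l₂)
    (g : Degeneracy x l₂ l₃) (h : Degeneracy x l₃ l₄) :
    comp (comp f g) h = comp f (comp g h) := by
  induction h generalizing l₁ l₂ with
  | nil x => rfl
  | dup h ih => simp [comp, ih]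
  | keep x h ih =>
    cases g with
    | dup g => simp [comp, ih]
    | keep _ g =>
      cases f with
      | dup f => simp [comp, ih]
      | keep _ f => simp [comp, ih]

/-- There are finitely many degeneracy operators with a given target. -/
lemma finite_sigma (x : Y) (l : List Y) : Finite (Σ l' : List Y, Degeneracy x l' l) := by
  induction l generalizing x with
  | nil =>
    refine Finite.of_surjective (fun _ : Unit => ⟨[], nil x⟩) ?_
    rintro ⟨_, ⟨⟩⟩
    exact ⟨(), rfl⟩
  | cons y l ih =>
    have := ih x
    have := ih y
    by_cases h : x = y
    · subst h
      refine Finite.of_surjective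
        (α := (Σ l' : List Y, Degeneracy x l' l) ⊕ (Σ l' : List Y, Degeneracy x l' l))
        (Sum.elim (fun p => ⟨x :: p.1, keep x p.2⟩) (fun p => ⟨p.1, dup p.2⟩)) ?_
      rintro ⟨_, f⟩
      cases f with
      | keep _ f => exact ⟨Sum.inl ⟨_, f⟩, rfl⟩
      | dup f => exact ⟨Sum.inr ⟨_, f⟩, rfl⟩
    · refine Finite.of_surjective
        (α := Σ l' : List Y, Degeneracy y l' l) (fun p => ⟨y :: p.1, keep x p.2⟩) ?_
      rintro ⟨_, f⟩
      cases f with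
      | keep _ f => exact ⟨⟨_, f⟩, rfl⟩
      | dup f => exact absurd rfl h

instance (x : Y) (l' l : List Y) : Finite (Degeneracy x l' l) := by
  have := finite_sigma x l
  refine Finite.of_injective
    (fun f => (⟨l', f⟩ : Σ l' : List Y, Degeneracy x l' l)) ?_
  intro f g h
  simpa using h

end Degeneracy

/-- The category of degeneracy operators between nonempty lists with head `x`. -/
structure DegeneracyCat {Y : Type w} (x : Y) where
  tail : List Y

instance {Y : Type w} (x : Y) : SmallCategory (DegeneracyCat x) where
  Hom a b := Degeneracy x a.tail b.tail
  id a := Degeneracy.id x a.tail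
  comp f g := Degeneracy.comp f g
  id_comp := Degeneracy.id_comp
  comp_id := Degeneracy.comp_id
  assoc := Degeneracy.comp_assoc

/-- The category of proper degeneracy operators with target `(x₀, …, xₙ)`, i.e. those from some
`(y₀, …, y_k)` with `k < n`. -/
abbrev LatchingCat {Y : Type w} (x : Y) (l : List Y) : Type w :=
  ObjectProperty.FullSubcategory
    (fun p : Over (DegeneracyCat.mk (x := x) l) => p.left.tail.length < l.length)

instance {Y : Type w} (x : Y) (l : List Y) : Finite (LatchingCat x l) := by
  have := Degeneracy.finite_sigma x l
  refine Finite.of_injective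
    (fun p => (⟨p.obj.left.tail, p.obj.hom⟩ : Σ l' : List Y, Degeneracy x l' l)) ?_
  rintro ⟨⟨⟨a⟩, ⟨⟨⟩⟩, f⟩, ha⟩ ⟨⟨⟨b⟩, ⟨⟨⟩⟩, g⟩, hb⟩ h
  simp only [Sigma.mk.injEq] at h
  obtain ⟨h₁, h₂⟩ := h
  subst h₁
  obtain rfl := eq_of_heq h₂
  rfl

instance {Y : Type w} (x : Y) (l : List Y) (p q : LatchingCat x l) : Finite (p ⟶ q) := by
  have : Finite (p.obj.left ⟶ q.obj.left) :=
    inferInstanceAs (Finite (Degeneracy x p.obj.left.tail q.obj.left.tail))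
  refine Finite.of_injective (fun f => f.hom.left) ?_
  intro f g h
  exact ObjectProperty.hom_ext _ (Over.OverMorphism.ext h)

noncomputable instance {Y : Type w} (x : Y) (l : List Y) : FinCategory (LatchingCat x l) where
  fintypeObj := Fintype.ofFinite _
  fintypeHom _ _ := Fintype.ofFinite _

variable {W : Type u₂} [Category.{v₂} W] [MonoidalCategory W] {Y : Type w}
  [EnrichedCategory W Y] (M : EnrichedBimodule W Y)

/-- `Y(x, y₁) ⊗ Y(y₁, y₂) ⊗ ⋯ ⊗ Y(y_{n-1}, y_n) ⊗ M(y_n, x₀)`. For `x₀ = x` this is the summand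
indexed by `(x, y₁, …, y_n)` of the `n`-th object of the simplicial bar construction. -/
def barSummand (x₀ : Y) : Y → List Y → W
  | x, [] => M.obj x x₀
  | x, y :: l => (x ⟶[W] y) ⊗ barSummand x₀ y l

/-- The map between summands of the bar construction induced by a degeneracy operator: it
inserts identities of `Y`. -/
def barDegeneracy (x₀ : Y) : {x : Y} → {l' l : List Y} → Degeneracy x l' l →
    (barSummand M x₀ x l' ⟶ barSummand M x₀ x l)
  | _, _, _, .nil x => 𝟙 (M.obj x x₀)
  | _, _, _, .keep x (y := y) f => (x ⟶[W] y) ◁ barDegeneracy x₀ f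
  | x, _, _, .dup (l := l) f =>
      barDegeneracy x₀ f ≫ (λ_ (barSummand M x₀ x l)).inv ≫ eId W x ▷ barSummand M x₀ x l

lemma insert_unit_naturality {A B C U : W} (h : C ⟶ A) (φ : A ⟶ B) (e : 𝟙_ W ⟶ U) :
    h ≫ φ ≫ (λ_ B).inv ≫ e ▷ B = (h ≫ (λ_ A).inv ≫ e ▷ A) ≫ U ◁ φ := by
  simp only [Category.assoc]
  rw [leftUnitor_inv_naturality_assoc, whisker_exchange]

lemma barDegeneracy_id (x₀ x : Y) (l : List Y) :
    barDegeneracy M x₀ (Degeneracy.id x l) = 𝟙 _ := by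
  induction l generalizing x with
  | nil => rfl
  | cons y l ih => simp [Degeneracy.id, barDegeneracy, ih, barSummand]

lemma barDegeneracy_comp (x₀ : Y) {x : Y} {l₁ l₂ l₃ : List Y} (f : Degeneracy x l₁ l₂)
    (g : Degeneracy x l₂ l₃) :
    barDegeneracy M x₀ (f.comp g) = barDegeneracy M x₀ f ≫ barDegeneracy M x₀ g := by
  induction g generalizing l₁ with
  | nil x => cases f; simp [Degeneracy.comp, barDegeneracy, barSummand]
  | dup g ih => simp [Degeneracy.comp, barDegeneracy, ih]
  | keep x g ih =>
    cases f with
    | keep _ f =>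
      simp only [Degeneracy.comp, barDegeneracy, ih]
      exact MonoidalCategory.whiskerLeft_comp _ _ _
    | dup f =>
      simp only [Degeneracy.comp, barDegeneracy, ih, Category.assoc]
      exact insert_unit_naturality _ _ _

/-- The summands of the bar construction, as a functor on degeneracy operators. -/
def barFunctor (x₀ x : Y) : DegeneracyCat x ⥤ W where
  obj a := barSummand M x₀ x a.tail
  map f := barDegeneracy M x₀ f
  map_id a := barDegeneracy_id M x₀ x a.tail
  map_comp f g := barDegeneracy_comp M x₀ f g

/-- The colimit of all summands of domains of degeneracy maps (from degrees `k < n`) that map into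
the summand `(x, y₁, …, y_n)`; for `x₀ = x` this is the latching object `L_{x, y₁, …, y_n}`. -/
noncomputable def latchingObject [HasFiniteColimits W] (x₀ x : Y) (l : List Y) : W :=
  colimit ((ObjectProperty.ι _ : LatchingCat x l ⥤ _) ⋙ Over.forget _ ⋙ barFunctor M x₀ x)

end Bar

section Weight

/-- The summand `B_{x₀,…,xₙ}(Y, M)` of the bar construction. -/
def barTerm {W : Type u₂} [Category.{v₂} W] [MonoidalCategory W] {Y : Type w}
    [EnrichedCategory W Y] (M : EnrichedBimodule W Y) {n : ℕ} (x : Fin (n + 1) → Y) : W :=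
  barSummand M (x 0) (x 0) (List.ofFn fun i : Fin n => x i.succ)

/-- The latching object `L_{x₀,…,xₙ} B(Y, M)`. -/
noncomputable def latchingTerm {W : Type u₂} [Category.{v₂} W] [MonoidalCategory W]
    [HasFiniteColimits W] {Y : Type w} [EnrichedCategory W Y] (M : EnrichedBimodule W Y) {n : ℕ}
    (x : Fin (n + 1) → Y) : W :=
  latchingObject M (x 0) (x 0) (List.ofFn fun i : Fin n => x i.succ)

variable {V : Type u₁} [Category.{v₁} V] [SemiCartesianMonoidalCategory V]
  {W : Type u₂} [Category.{v₂} W] [MonoidalCategory W] [ModelCategory W]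
  {k : Type u} [CommRing k]

/-- `wgt(x₀, …, xₙ) = χ(B_{x₀,…,xₙ}(Σ X, 𝟙)) - χ(L_{x₀,…,xₙ} B(Σ X, 𝟙))`. -/
noncomputable def wgt (χ : EulerCharacteristic W k) (S : V ⥤ W) [S.Monoidal] (X : Type w)
    [EnrichedCategory V X] {n : ℕ} (x : Fin (n + 1) → X) : k :=
  χ.chi (barTerm (unitBimodule S X) x) - χ.chi (latchingTerm (unitBimodule S X) x)

/-- The formal power series `∑ₙ tⁿ ∑_{x₀,…,xₙ} wgt(x₀, …, xₙ)`. -/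
noncomputable def wgtSeries (χ : EulerCharacteristic W k) (S : V ⥤ W) [S.Monoidal] (X : Type w)
    [EnrichedCategory V X] [Fintype X] : PowerSeries k :=
  PowerSeries.mk fun n => ∑ x : Fin (n + 1) → X, wgt χ S X x

end Weight

/-! ### Power series that are rational functions -/

section Rational

/-- The power series `F ∈ k[[t]]` is a rational function `P / Q`, where `P` and `Q` are polynomials
and `Q` is invertible in `k[[t]]`, which can be evaluated at `t = a` (i.e. `Q(a)` is invertible),
with value `P(a) / Q(a) = v`. -/
def IsRationalWithValue {k : Type u} [CommRing k] (F : PowerSeries k) (a v : k) : Prop :=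
  ∃ P Q : Polynomial k, IsUnit (Q : PowerSeries k) ∧ (Q : PowerSeries k) * F = (P : PowerSeries k) ∧
    IsUnit (Q.eval a) ∧ Q.eval a * v = P.eval a

/-- The value does not depend on the choice of `P` and `Q`. -/
theorem IsRationalWithValue.unique {k : Type u} [CommRing k] {F : PowerSeries k} {a v v' : k}
    (h : IsRationalWithValue F a v) (h' : IsRationalWithValue F a v') : v = v' := by
  obtain ⟨P, Q, -, hF, hu, hv⟩ := h
  obtain ⟨P', Q', -, hF', hu', hv'⟩ := h'
  have h₁ : Q * P' = Q' * P := by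
    apply Polynomial.coe_injective k
    rw [Polynomial.coe_mul, Polynomial.coe_mul, ← hF, ← hF']
    ring
  have h₂ := congrArg (Polynomial.eval a) h₁
  rw [Polynomial.eval_mul, Polynomial.eval_mul, ← hv, ← hv'] at h₂
  exact (hu.mul hu').mul_left_cancel (by linear_combination -h₂)


open RatFunc in
/-- Over a field `K`, `IsRationalWithValue` says that the image of `F` in `K((t))` is the image of
an element of `K(t)` whose denominator does not vanish at `a` and whose value at `a` is `v`. -/
theorem isRationalWithValue_iff {K : Type u} [Field K] (F : PowerSeries K) (a v : K) :
    IsRationalWithValue F a v ↔ ∃ r : RatFunc K,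
      algebraMap (RatFunc K) (LaurentSeries K) r = HahnSeries.ofPowerSeries ℤ K F ∧
      r.denom.eval a ≠ 0 ∧ r.eval (RingHom.id K) a = v := by
  have key (P : Polynomial K) : algebraMap (RatFunc K) (LaurentSeries K)
      (algebraMap (Polynomial K) (RatFunc K) P) = HahnSeries.ofPowerSeries ℤ K (P : PowerSeries K) :=
    (RatFunc.coe_coe P).symm
  constructor
  · rintro ⟨P, Q, hQ, hF, hu, hv⟩
    have hQ0 : Q ≠ 0 := by
      rintro rfl
      simp at hu
    have hQ1 : algebraMap (Polynomial K) (RatFunc K) Q ≠ 0 := RatFunc.algebraMap_ne_zero hQ0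
    have hd : (algebraMap (Polynomial K) (RatFunc K) P / algebraMap _ _ Q).denom.eval a ≠ 0 := by
      intro h
      obtain ⟨c, hc⟩ := RatFunc.denom_div_dvd P Q
      apply hu.ne_zero
      rw [hc, Polynomial.eval_mul, h, zero_mul]
    refine ⟨algebraMap _ _ P / algebraMap _ _ Q, ?_, hd, ?_⟩
    · rw [map_div₀, div_eq_iff ((map_ne_zero _).2 hQ1), key, key, ← map_mul, ← hF, mul_comm]
    · rw [RatFunc.eval, div_eq_iff (by simpa using hd)]
      have h := congrArg (Polynomial.eval a) ((RatFunc.num_mul_eq_mul_denom_iff (x :=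
        algebraMap (Polynomial K) (RatFunc K) P / algebraMap _ _ Q) hQ0).2 rfl)
      rw [Polynomial.eval_mul, Polynomial.eval_mul, ← hv] at h
      rw [← Polynomial.eval, ← Polynomial.eval]
      exact mul_left_cancel₀ hu.ne_zero (by linear_combination h)
  · rintro ⟨r, hr, hd, hv⟩
    have hF : (r.denom : PowerSeries K) * F = (r.num : PowerSeries K) := by
      apply HahnSeries.ofPowerSeries_injective (Γ := ℤ)
      rw [map_mul, ← hr, ← key, ← key, ← map_mul, mul_comm]
      congr 1
      rw [← eq_div_iff (RatFunc.algebraMap_ne_zero r.denom_ne_zero), RatFunc.num_div_denom]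
    refine ⟨r.num, r.denom, ?_, hF, hd.isUnit, ?_⟩
    · rw [PowerSeries.isUnit_iff_constantCoeff, isUnit_iff_ne_zero, Polynomial.constantCoeff_coe]
      intro h0
      have h1 : r.num.coeff 0 = 0 := by
        have := congrArg (PowerSeries.constantCoeff (R := K)) hF
        rwa [map_mul, Polynomial.constantCoeff_coe, Polynomial.constantCoeff_coe, h0, zero_mul,
          eq_comm] at this
      obtain ⟨x, y, hxy⟩ := r.isCoprime_num_denom
      have := congrArg (fun p : Polynomial K => p.coeff 0) hxy
      simp [Polynomial.mul_coeff_zero, h0, h1] at this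
    · rw [← hv, RatFunc.eval, ← Polynomial.eval, ← Polynomial.eval]
      exact mul_div_cancel₀ _ hd

end Rational

/-!
Write `Y = Σ X`, and `Z` for its zeta matrix. The relative Euler characteristic `χ B - χ A` of a
cofibration `A ⟶ B` between finite cofibrant objects is multiplicative under pushout products. The
latching map at `x :: y :: l` is the pushout product of the latching map at `y :: l` with the
identity-assigning map `𝟙_ W ⟶ Y(x, x)` if `x = y` and with `⊥_ W ⟶ Y(x, y)` if `x ≠ y`, and these
have relative Euler characteristic `(Z - 1) x y`. Therefore the weight of a list is the product of
the entries of `Z - 1` along it. Hence `F(t) = ∑ₙ tⁿ tr ((Z - 1)ⁿ J) = tr ((1 - t (Z - 1))⁻¹ J)`,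
where all entries of `J` are `1`; this is rational by Cramer's rule, and at `t = -1` it is
`tr (Z⁻¹ J)`, the magnitude.
-/

section LatchingObject

variable {Y : Type w} {x : Y} {l : List Y}

/-- The diagram whose colimit is a latching object, for an arbitrary functor `G` on degeneracy
operators; for `G = barFunctor M x₀ x` its colimit is `latchingObject M x₀ x l`. -/
abbrev latchingDiagram {E : Type*} [Category* E] (G : DegeneracyCat x ⥤ E) (l : List Y) :
    LatchingCat x l ⥤ E :=
  (ObjectProperty.ι _ : LatchingCat x l ⥤ _) ⋙ Over.forget _ ⋙ G

/-- A cocone on a latching diagram, from a compatible family indexed by the proper degeneracy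
operators with target `x :: l`. -/
def latchingCocone {E : Type*} [Category* E] (G : DegeneracyCat x ⥤ E) {T : E}
    (t : ∀ {l' : List Y}, Degeneracy x l' l → l'.length < l.length → (G.obj ⟨l'⟩ ⟶ T))
    (ht : ∀ {l'' l' : List Y} (φ : Degeneracy x l'' l') (f : Degeneracy x l' l)
      (h' : l''.length < l.length) (h : l'.length < l.length),
      G.map (X := ⟨l''⟩) (Y := ⟨l'⟩) φ ≫ t f h = t (φ.comp f) h') :
    Cocone (latchingDiagram G l) where
  pt := T
  ι :=
    { app p := t p.obj.hom p.property
      naturality p q g := by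
        have hg : p.obj.hom = Degeneracy.comp g.hom.left q.obj.hom := (Over.w g.hom).symm
        simp only [hg]
        exact (ht g.hom.left q.obj.hom p.property q.property).trans (Category.comp_id _).symm }

variable {W : Type u₂} [Category.{v₂} W] [MonoidalCategory W] [EnrichedCategory W Y]

/-- The map `A ⟶ Y(x, x) ⊗ A` given by the identity of `x`, by which the degeneracy operators
`Degeneracy.dup` act. -/
def insertUnit (x : Y) (A : W) : A ⟶ (x ⟶[W] x) ⊗ A :=
  (λ_ A).inv ≫ eId W x ▷ A

lemma comp_insertUnit (x : Y) {A B : W} (f : A ⟶ B) :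
    f ≫ insertUnit x B = insertUnit x A ≫ (x ⟶[W] x) ◁ f := by
  rw [insertUnit, insertUnit, Category.assoc, leftUnitor_inv_naturality_assoc, whisker_exchange]

variable (M : EnrichedBimodule W Y) (x₀ : Y)

lemma barDegeneracy_dup {l' : List Y} (f : Degeneracy x l' l) :
    barDegeneracy M x₀ (.dup f) = barDegeneracy M x₀ f ≫ insertUnit x (barSummand M x₀ x l) :=
  rfl

lemma barDegeneracy_dup_id (x : Y) (l : List Y) :
    barDegeneracy M x₀ (.dup (.id x l)) = insertUnit x (barSummand M x₀ x l) := by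
  rw [barDegeneracy_dup, barDegeneracy_id, Category.id_comp]

variable [HasFiniteColimits W]

/-- The leg of the colimit cocone of a latching object at a proper degeneracy operator. -/
noncomputable def latchingι {l' : List Y} (f : Degeneracy x l' l) (h : l'.length < l.length) :
    barSummand M x₀ x l' ⟶ latchingObject M x₀ x l :=
  colimit.ι (latchingDiagram (barFunctor M x₀ x) l) ⟨Over.mk (Y := DegeneracyCat.mk l') f, h⟩

lemma barDegeneracy_latchingι {l'' l' : List Y} (φ : Degeneracy x l'' l') (f : Degeneracy x l' l)
    (h' : l''.length < l.length) (h : l'.length < l.length) :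
    barDegeneracy M x₀ φ ≫ latchingι M x₀ f h = latchingι M x₀ (φ.comp f) h' :=
  let p : LatchingCat x l := ⟨Over.mk (Y := DegeneracyCat.mk l'') (φ.comp f), h'⟩
  let q : LatchingCat x l := ⟨Over.mk (Y := DegeneracyCat.mk l') f, h⟩
  colimit.w (latchingDiagram (barFunctor M x₀ x) l)
    (ObjectProperty.homMk (Over.homMk (U := p.obj) (V := q.obj) φ rfl) : p ⟶ q)

section Desc

variable {M x₀} {T : W}
  (t : ∀ {l' : List Y}, Degeneracy x l' l → l'.length < l.length → (barSummand M x₀ x l' ⟶ T))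
  (ht : ∀ {l'' l' : List Y} (φ : Degeneracy x l'' l') (f : Degeneracy x l' l)
    (h' : l''.length < l.length) (h : l'.length < l.length),
    barDegeneracy M x₀ φ ≫ t f h = t (φ.comp f) h')

/-- The map out of a latching object given by a compatible family indexed by the proper degeneracy
operators. -/
noncomputable def latchingDesc : latchingObject M x₀ x l ⟶ T :=
  colimit.desc _ (latchingCocone (barFunctor M x₀ x) t ht)

lemma latchingι_latchingDesc {l' : List Y} (f : Degeneracy x l' l) (h : l'.length < l.length) :
    latchingι M x₀ f h ≫ latchingDesc t ht = t f h :=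
  colimit.ι_desc _ _

end Desc

variable {M x₀}

lemma latchingObject_hom_ext {T : W} {a b : latchingObject M x₀ x l ⟶ T}
    (hab : ∀ {l' : List Y} (f : Degeneracy x l' l) (h : l'.length < l.length),
      latchingι M x₀ f h ≫ a = latchingι M x₀ f h ≫ b) : a = b :=
  colimit.hom_ext fun p => hab p.obj.hom p.property

lemma tensor_latchingObject_hom_ext {A : W} [PreservesFiniteColimits (tensorLeft A)] {T : W}
    {a b : A ⊗ latchingObject M x₀ x l ⟶ T}
    (hab : ∀ {l' : List Y} (f : Degeneracy x l' l) (h : l'.length < l.length),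
      A ◁ latchingι M x₀ f h ≫ a = A ◁ latchingι M x₀ f h ≫ b) : a = b :=
  (isColimitOfPreserves (tensorLeft A) (colimit.isColimit _)).hom_ext fun p =>
    hab p.obj.hom p.property

variable (M x₀)

/-- The map from a latching object to the summand of the bar construction with the same index which
is induced by the degeneracy operators. -/
noncomputable def latchingMap (x : Y) (l : List Y) :
    latchingObject M x₀ x l ⟶ barSummand M x₀ x l :=
  latchingDesc (fun f _ => barDegeneracy M x₀ f) fun φ f _ _ => (barDegeneracy_comp M x₀ φ f).symm

lemma latchingι_latchingMap {l' : List Y} (f : Degeneracy x l' l) (h : l'.length < l.length) :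
    latchingι M x₀ f h ≫ latchingMap M x₀ x l = barDegeneracy M x₀ f :=
  latchingι_latchingDesc _ (fun φ f _ _ => (barDegeneracy_comp M x₀ φ f).symm) f h

/-- A list with one entry is the target of no proper degeneracy operator. -/
noncomputable def isInitialLatchingObjectNil (x : Y) : IsInitial (latchingObject M x₀ x []) :=
  have : IsEmpty (LatchingCat x []) := ⟨fun p => absurd p.property (Nat.not_lt_zero _)⟩
  isColimitEquivIsInitialOfIsEmpty _ _ (colimit.isColimit _)

section Keep

variable (x y : Y) (l : List Y)

/-- The part of `latchingObject M x₀ x (y :: l)` coming from degeneracy operators which do not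
repeat `x`, i.e. from those of the form `Degeneracy.keep x f`. -/
noncomputable def latchingKeep [PreservesFiniteColimits (tensorLeft (x ⟶[W] y))] :
    (x ⟶[W] y) ⊗ latchingObject M x₀ y l ⟶ latchingObject M x₀ x (y :: l) :=
  (isColimitOfPreserves (tensorLeft (x ⟶[W] y))
    (colimit.isColimit (latchingDiagram (barFunctor M x₀ y) l))).desc
    (latchingCocone (barFunctor M x₀ y ⋙ tensorLeft (x ⟶[W] y))
      (fun f h => latchingι M x₀ (.keep x f) (Nat.succ_lt_succ h))
      fun φ f _ _ => barDegeneracy_latchingι M x₀ (.keep x φ) (.keep x f) _ _)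

/-- The part of `latchingObject M x₀ x (x :: l)` coming from degeneracy operators which repeat `x`,
all of which factor through the one that does nothing else. -/
noncomputable def latchingDup : barSummand M x₀ x l ⟶ latchingObject M x₀ x (x :: l) :=
  latchingι M x₀ (.dup (.id x l)) (Nat.lt_succ_self _)

variable {x y l}

lemma whiskerLeft_latchingι_latchingKeep [PreservesFiniteColimits (tensorLeft (x ⟶[W] y))]
    {l' : List Y} (f : Degeneracy y l' l) (h : l'.length < l.length) :
    (x ⟶[W] y) ◁ latchingι M x₀ f h ≫ latchingKeep M x₀ x y l =
      latchingι M x₀ (.keep x f) (Nat.succ_lt_succ h) :=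
  (isColimitOfPreserves (tensorLeft (x ⟶[W] y))
    (colimit.isColimit (latchingDiagram (barFunctor M x₀ y) l))).fac _ _

lemma latchingKeep_latchingMap [PreservesFiniteColimits (tensorLeft (x ⟶[W] y))] :
    latchingKeep M x₀ x y l ≫ latchingMap M x₀ x (y :: l) =
      (x ⟶[W] y) ◁ latchingMap M x₀ y l := by
  refine tensor_latchingObject_hom_ext fun f h => ?_
  rw [reassoc_of% whiskerLeft_latchingι_latchingKeep]
  exact (latchingι_latchingMap M x₀ (.keep x f) _).trans <|
    (congrArg _ (latchingι_latchingMap M x₀ f h)).symm.trans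
      (MonoidalCategory.whiskerLeft_comp _ _ _)

lemma barDegeneracy_latchingDup {l' : List Y} (f : Degeneracy x l' l)
    (h : l'.length < (x :: l).length) :
    barDegeneracy M x₀ f ≫ latchingDup M x₀ x l = latchingι M x₀ (.dup f) h := by
  rw [latchingDup, barDegeneracy_latchingι (h' := h)]
  simp only [Degeneracy.comp, Degeneracy.comp_id]

lemma latchingDup_latchingMap :
    latchingDup M x₀ x l ≫ latchingMap M x₀ x (x :: l) = insertUnit x (barSummand M x₀ x l) := by
  rw [latchingDup, latchingι_latchingMap, barDegeneracy_dup_id]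

end Keep

lemma isIso_latchingKeep {x y : Y} (hxy : x ≠ y) (l : List Y)
    [PreservesFiniteColimits (tensorLeft (x ⟶[W] y))] : IsIso (latchingKeep M x₀ x y l) := by
  let t {l' : List Y} : Degeneracy x l' (y :: l) → l'.length < (y :: l).length →
      (barSummand M x₀ x l' ⟶ (x ⟶[W] y) ⊗ latchingObject M x₀ y l)
    | .keep _ f, h => (x ⟶[W] y) ◁ latchingι M x₀ f (Nat.lt_of_succ_lt_succ h)
    | .dup _, _ => absurd rfl hxy
  have ht {l'' l' : List Y} (φ : Degeneracy x l'' l') (f : Degeneracy x l' (y :: l))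
      (h' : l''.length < (y :: l).length) (h : l'.length < (y :: l).length) :
      barDegeneracy M x₀ φ ≫ t f h = t (φ.comp f) h' := by
    cases f with
    | dup => exact absurd rfl hxy
    | keep _ f =>
      cases φ with
      | dup => exact absurd rfl hxy
      | keep _ φ =>
        exact (MonoidalCategory.whiskerLeft_comp _ _ _).symm.trans
          (congrArg _ (barDegeneracy_latchingι M x₀ φ f _ _))
  refine ⟨latchingDesc t ht, tensor_latchingObject_hom_ext fun f h => ?_,
    latchingObject_hom_ext fun f h => ?_⟩
  · rw [reassoc_of% whiskerLeft_latchingι_latchingKeep, Category.comp_id]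
    exact latchingι_latchingDesc t ht (.keep x f) _
  · rw [reassoc_of% latchingι_latchingDesc, Category.comp_id]
    cases f with
    | dup => exact absurd rfl hxy
    | keep _ f => exact whiskerLeft_latchingι_latchingKeep M x₀ f _

section Pushout

variable (x : Y) (l : List Y) [PreservesFiniteColimits (tensorLeft (x ⟶[W] x))]

lemma insertUnit_latchingKeep :
    insertUnit x (latchingObject M x₀ x l) ≫ latchingKeep M x₀ x x l =
      latchingMap M x₀ x l ≫ latchingDup M x₀ x l := by
  refine latchingObject_hom_ext fun {l'} f h => ?_
  have h' : l'.length < (x :: l).length := h.trans (Nat.lt_succ_self _)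
  rw [reassoc_of% comp_insertUnit, whiskerLeft_latchingι_latchingKeep,
    reassoc_of% latchingι_latchingMap, barDegeneracy_latchingDup M x₀ f h', ← barDegeneracy_dup_id]
  refine (barDegeneracy_latchingι M x₀ (.dup (.id x _)) (.keep x f) h' _).trans ?_
  simp only [Degeneracy.comp, Degeneracy.id_comp]

variable {M x₀ x l} {T : W}

lemma latchingObject_cons_hom_ext {a b : latchingObject M x₀ x (x :: l) ⟶ T}
    (hkeep : latchingKeep M x₀ x x l ≫ a = latchingKeep M x₀ x x l ≫ b)
    (hdup : latchingDup M x₀ x l ≫ a = latchingDup M x₀ x l ≫ b) : a = b := by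
  refine latchingObject_hom_ext fun f h => ?_
  cases f with
  | keep _ f =>
    have h' := Nat.lt_of_succ_lt_succ h
    rw [← whiskerLeft_latchingι_latchingKeep M x₀ f h']
    exact (Category.assoc _ _ _).trans ((congrArg _ hkeep).trans (Category.assoc _ _ _).symm)
  | dup f =>
    rw [← barDegeneracy_latchingDup M x₀ f h, Category.assoc, Category.assoc, hdup]

lemma exists_latchingKeep_comp_eq (a : (x ⟶[W] x) ⊗ latchingObject M x₀ x l ⟶ T)
    (b : barSummand M x₀ x l ⟶ T)
    (hab : insertUnit x (latchingObject M x₀ x l) ≫ a = latchingMap M x₀ x l ≫ b) :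
    ∃ c : latchingObject M x₀ x (x :: l) ⟶ T,
      latchingKeep M x₀ x x l ≫ c = a ∧ latchingDup M x₀ x l ≫ c = b := by
  let t {l' : List Y} : Degeneracy x l' (x :: l) → l'.length < (x :: l).length →
      (barSummand M x₀ x l' ⟶ T)
    | .keep _ f, h => (x ⟶[W] x) ◁ latchingι M x₀ f (Nat.lt_of_succ_lt_succ h) ≫ a
    | .dup f, _ => barDegeneracy M x₀ f ≫ b
  have ht {l'' l' : List Y} (φ : Degeneracy x l'' l') (f : Degeneracy x l' (x :: l))
      (h' : l''.length < (x :: l).length) (h : l'.length < (x :: l).length) :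
      barDegeneracy M x₀ φ ≫ t f h = t (φ.comp f) h' := by
    cases f with
    | dup f =>
      simp only [t, Degeneracy.comp, barDegeneracy_comp, Category.assoc]
    | keep _ f =>
      have hf := Nat.lt_of_succ_lt_succ h
      cases φ with
      | keep _ φ =>
        exact (MonoidalCategory.whiskerLeft_comp_assoc _ _ _ a).symm.trans
          (congrArg ((x ⟶[W] x) ◁ · ≫ a) (barDegeneracy_latchingι M x₀ φ f _ hf))
      | dup φ =>
        change (barDegeneracy M x₀ φ ≫ insertUnit x _) ≫ _ ◁ latchingι M x₀ f hf ≫ a =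
          barDegeneracy M x₀ (φ.comp f) ≫ b
        rw [Category.assoc, ← reassoc_of% comp_insertUnit, hab,
          reassoc_of% latchingι_latchingMap, barDegeneracy_comp, Category.assoc]
  refine ⟨latchingDesc t ht, tensor_latchingObject_hom_ext fun f h => ?_, ?_⟩
  · rw [reassoc_of% whiskerLeft_latchingι_latchingKeep]
    exact latchingι_latchingDesc t ht (.keep x f) _
  · rw [latchingDup, latchingι_latchingDesc]
    simp only [t, barDegeneracy_id, Category.id_comp]

variable (M x₀ x l)

lemma isPushout_latchingKeep_latchingDup :
    IsPushout (insertUnit x (latchingObject M x₀ x l)) (latchingMap M x₀ x l)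
      (latchingKeep M x₀ x x l) (latchingDup M x₀ x l) :=
  ⟨⟨insertUnit_latchingKeep M x₀ x l⟩, ⟨PushoutCocone.isColimitAux' _ fun s =>
    have h := exists_latchingKeep_comp_eq s.inl s.inr s.condition
    ⟨h.choose, h.choose_spec.1, h.choose_spec.2, fun hk hd =>
      latchingObject_cons_hom_ext (hk.trans h.choose_spec.1.symm)
        (hd.trans h.choose_spec.2.symm)⟩⟩⟩

end Pushout

end LatchingObject

section PushoutProduct

variable {W : Type u₂} [Category.{v₂} W] [MonoidalCategory W] [HasInitial W]

section InitialTo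

variable [∀ A : W, PreservesColimitsOfShape (Discrete PEmpty.{1}) (tensorRight A)]

/-- The pushout product of `⊥_ W ⟶ A` and `g : K ⟶ L` is `A ◁ g`. Its source is only determined up
to an isomorphism `i`, and can be chosen to be any `P` isomorphic to `A ⊗ K`. -/
noncomputable def pushoutProductInitialTo (A : W) {K L P : W} (g : K ⟶ L) (i : A ⊗ K ⟶ P)
    [IsIso i] (ι : P ⟶ A ⊗ L) (hι : i ≫ ι = A ◁ g) :
    (curriedTensor W).PushoutObjObj (initial.to A) g :=
  have hI (B : W) : IsInitial ((⊥_ W) ⊗ B) :=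
    IsInitial.isInitialObj (tensorRight B) _ initialIsInitial
  have : IsIso (((curriedTensor W).obj (⊥_ W)).map g) :=
    isIso_of_isInitial (hI K) (hI L) _
  { pt := P
    inl := i
    inr := (hI L).to P
    isPushout := IsPushout.of_vert_isIso ⟨(hI K).hom_ext _ _⟩
    ι := ι
    inl_ι := hι
    inr_ι := (hI L).hom_ext _ _ }

end InitialTo

/-- The pushout product of `f : A ⟶ B` and `⊥_ W ⟶ K` is `f ▷ K`. -/
noncomputable def pushoutProductToInitial
    [∀ A : W, PreservesColimitsOfShape (Discrete PEmpty.{1}) (tensorLeft A)] {A B : W} (f : A ⟶ B)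
    (K : W) : (curriedTensor W).PushoutObjObj f (initial.to K) :=
  have hI (A : W) : IsInitial (A ⊗ ⊥_ W) :=
    IsInitial.isInitialObj (tensorLeft A) _ initialIsInitial
  have : IsIso (((curriedTensor W).map f).app (⊥_ W)) :=
    isIso_of_isInitial (hI A) (hI B) _
  { pt := A ⊗ K
    inl := (hI B).to _
    inr := 𝟙 _
    isPushout := IsPushout.of_horiz_isIso ⟨(hI A).hom_ext _ _⟩
    ι := f ▷ K
    inl_ι := (hI B).hom_ext _ _
    inr_ι := Category.id_comp _ }

end PushoutProduct

section MonoidalModelCategory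

variable {W : Type u₂} [Category.{v₂} W] [MonoidalCategory W] [ModelCategory W]
  [IsMonoidalModelCategory W]

lemma cofibration_whiskerLeft
    [∀ A : W, PreservesColimitsOfShape (Discrete PEmpty.{1}) (tensorRight A)] (A : W)
    [hA : IsCofibrant A] {K L : W} (g : K ⟶ L) [hg : Cofibration g] : Cofibration (A ◁ g) :=
  IsMonoidalModelCategory.cofibration_ι _ _
    (pushoutProductInitialTo A g (𝟙 _) (A ◁ g) (Category.id_comp _)) hA hg

variable [∀ A : W, PreservesColimitsOfShape (Discrete PEmpty.{1}) (tensorLeft A)]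

lemma cofibration_whiskerRight {A B : W} (f : A ⟶ B) [hf : Cofibration f] (K : W)
    [hK : IsCofibrant K] : Cofibration (f ▷ K) :=
  IsMonoidalModelCategory.cofibration_ι _ _ (pushoutProductToInitial f K) hf hK

lemma isCofibrant_tensor
    [∀ A : W, PreservesColimitsOfShape (Discrete PEmpty.{1}) (tensorRight A)] (A B : W)
    [IsCofibrant A] [IsCofibrant B] : IsCofibrant (A ⊗ B) :=
  (isCofibrant_iff_of_isInitial _
    (IsInitial.isInitialObj (tensorLeft A) _ initialIsInitial)).2
      (cofibration_whiskerLeft A (initial.to B))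

end MonoidalModelCategory

namespace EulerCharacteristic

variable {W : Type u₂} [Category.{v₂} W] [ModelCategory W] {k : Type u}

section AddCommGroup

variable [AddCommGroup k] (χ : EulerCharacteristic W k)

lemma isFinite_iff_of_iso {A B : W} (e : A ≅ B) : χ.IsFinite A ↔ χ.IsFinite B :=
  χ.isFinite_iff_of_weakEquivalence e.hom inferInstance

lemma chi_eq_of_iso {A B : W} (e : A ≅ B) (hA : χ.IsFinite A) : χ.chi A = χ.chi B :=
  χ.chi_eq_of_weakEquivalence e.hom inferInstance hA

/-- `χ.HasRelativeChi f c` says that `f : A ⟶ B` is a cofibration between finite cofibrant objects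
and that its relative Euler characteristic `χ B - χ A` is `c`. -/
structure HasRelativeChi {A B : W} (f : A ⟶ B) (c : k) : Prop where
  isCofibrant_source : IsCofibrant A
  cofibration : Cofibration f
  isFinite_source : χ.IsFinite A
  isFinite_target : χ.IsFinite B
  chi_sub_chi : χ.chi B - χ.chi A = c

variable {χ}

lemma HasRelativeChi.isCofibrant_target {A B : W} {f : A ⟶ B} {c : k} (hf : χ.HasRelativeChi f c) :
    IsCofibrant B :=
  have := hf.isCofibrant_source
  have := hf.cofibration
  isCofibrant_of_cofibration f

lemma hasRelativeChi_of_isInitial {A B : W} (f : A ⟶ B) (hA : IsInitial A) [hB : IsCofibrant B]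
    (hBfin : χ.IsFinite B) : χ.HasRelativeChi f (χ.chi B) where
  isCofibrant_source := (isCofibrant_iff_of_isInitial (𝟙 A) hA).2 inferInstance
  cofibration := (isCofibrant_iff_of_isInitial f hA).1 hB
  isFinite_source := (χ.isFinite_iff_of_iso (initialIsInitial.uniqueUpToIso hA)).1
    χ.isFinite_initial
  isFinite_target := hBfin
  chi_sub_chi := by
    rw [← χ.chi_eq_of_iso (initialIsInitial.uniqueUpToIso hA) χ.isFinite_initial, χ.chi_initial,
      sub_zero]

end AddCommGroup

lemma isHomotopyPushout_of_isPushout {A B C P : W} {f : A ⟶ B} {g : A ⟶ C} {i : B ⟶ P}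
    {j : C ⟶ P} (sq : IsPushout f g i j) (hA : IsCofibrant A) (hf : Cofibration f)
    (hg : Cofibration g) : IsHomotopyPushout f g P :=
  ⟨A, B, C, f, g, 𝟙 _, 𝟙 _, 𝟙 _, i, j, hA, hf, hg, inferInstance, inferInstance, inferInstance,
    by simp only [Category.comp_id, Category.id_comp],
    by simp only [Category.comp_id, Category.id_comp], sq⟩

variable [MonoidalCategory W] [IsMonoidalModelCategory W] [CommRing k]
  {χ : EulerCharacteristic W k}

lemma HasRelativeChi.pushoutProduct
    [∀ A : W, PreservesColimitsOfShape (Discrete PEmpty.{1}) (tensorLeft A)]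
    [∀ A : W, PreservesColimitsOfShape (Discrete PEmpty.{1}) (tensorRight A)]
    (hχ : χ.IsMultiplicative) {A B K L : W} {f : A ⟶ B} {g : K ⟶ L} {a b : k}
    (hf : χ.HasRelativeChi f a) (hg : χ.HasRelativeChi g b)
    (sq : (curriedTensor W).PushoutObjObj f g) : χ.HasRelativeChi sq.ι (a * b) := by
  have hA := hf.isCofibrant_source
  have hB := hf.isCofibrant_target
  have hK := hg.isCofibrant_source
  have hL := hg.isCofibrant_target
  have := hf.cofibration
  have := hg.cofibration
  have hfK : Cofibration (f ▷ K) := cofibration_whiskerRight f K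
  have hAg : Cofibration (A ◁ g) := cofibration_whiskerLeft A g
  have hBK : IsCofibrant (B ⊗ K) := isCofibrant_tensor B K
  have hpo : IsPushout (f ▷ K) (A ◁ g) sq.inl sq.inr := sq.isPushout
  have hhpo := isHomotopyPushout_of_isPushout hpo (isCofibrant_tensor A K) hfK hAg
  have hinl : Cofibration sq.inl :=
    (cofibration_iff _).2 (MorphismProperty.of_isPushout hpo hAg.mem)
  have finite_tensor {C D : W} := hχ.isFinite_tensor C D
  have hAK := finite_tensor hf.isFinite_source hg.isFinite_source hA hK
  have hBKfin := finite_tensor hf.isFinite_target hg.isFinite_source hB hK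
  have hALfin := finite_tensor hf.isFinite_source hg.isFinite_target hA hL
  refine ⟨isCofibrant_of_cofibration (X := B ⊗ K) sq.inl,
    IsMonoidalModelCategory.cofibration_ι f g sq hf.cofibration hg.cofibration,
    χ.isFinite_homotopyPushout _ _ _ hAK hBKfin hALfin hhpo,
    finite_tensor hf.isFinite_target hg.isFinite_target hB hL, ?_⟩
  calc χ.chi (B ⊗ L) - χ.chi sq.pt
      = χ.chi (B ⊗ L) - (χ.chi (B ⊗ K) + χ.chi (A ⊗ L) - χ.chi (A ⊗ K)) := by
        rw [χ.chi_homotopyPushout _ _ _ hAK hBKfin hALfin hhpo]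
    _ = (χ.chi B - χ.chi A) * (χ.chi L - χ.chi K) := by
        rw [hχ.chi_tensor _ _ hf.isFinite_target hg.isFinite_target hB hL,
          hχ.chi_tensor _ _ hf.isFinite_target hg.isFinite_source hB hK,
          hχ.chi_tensor _ _ hf.isFinite_source hg.isFinite_target hA hL,
          hχ.chi_tensor _ _ hf.isFinite_source hg.isFinite_source hA hK]
        ring
    _ = a * b := by rw [hf.chi_sub_chi, hg.chi_sub_chi]

lemma hasRelativeChi_eId {Y : Type w} [EnrichedCategory W Y] (hχ : χ.IsMultiplicative) (x : Y)
    (hx : Cofibration (eId W x)) (hfin : χ.IsFinite (x ⟶[W] x)) :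
    χ.HasRelativeChi (eId W x) (χ.chi (x ⟶[W] x) - 1) :=
  ⟨IsMonoidalModelCategory.isCofibrant_unit, hx, hχ.isFinite_unit, hfin, by rw [hχ.chi_unit]⟩

end EulerCharacteristic

section PathWeight

variable {Y : Type w} {k : Type u} [CommRing k]

/-- The product of the entries of the matrix `A` along the path `x :: l`, times the entry of the
vector `v` at its end. -/
def pathWeight (A : Matrix Y Y k) (v : Y → k) : Y → List Y → k
  | x, [] => v x
  | x, y :: l => A x y * pathWeight A v y l

variable [Fintype Y]

lemma sum_fin_succ_fun {β : Type*} [AddCommMonoid β] {n : ℕ} (f : (Fin (n + 1) → Y) → β) :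
    ∑ x, f x = ∑ y, ∑ x : Fin n → Y, f (Fin.cons y x) := by
  rw [← (Fin.consEquiv fun _ : Fin (n + 1) => Y).sum_comp, Fintype.sum_prod_type]
  rfl

variable [DecidableEq Y]

open Matrix in
lemma sum_pathWeight_ofFn (A : Matrix Y Y k) (v : Y → k) (n : ℕ) (a : Y) :
    ∑ x : Fin n → Y, pathWeight A v a (List.ofFn x) = (A ^ n *ᵥ v) a := by
  induction n generalizing a with
  | zero =>
    simp only [Finset.univ_unique, List.ofFn_zero, pathWeight, Finset.sum_singleton, pow_zero,
      one_mulVec]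
  | succ n ih =>
    simp only [sum_fin_succ_fun, List.ofFn_cons, pathWeight, ← Finset.mul_sum, ih]
    rw [pow_succ', ← mulVec_mulVec]
    rfl

lemma sum_pathWeight_eq_trace (A M : Matrix Y Y k) (n : ℕ) :
    ∑ x : Fin (n + 1) → Y,
      pathWeight A (fun y => M y (x 0)) (x 0) (List.ofFn fun i : Fin n => x i.succ) =
      (A ^ n * M).trace := by
  simp only [sum_fin_succ_fun, Fin.cons_zero, Fin.cons_succ, sum_pathWeight_ofFn]
  rfl

end PathWeight

section GeometricSeries

open Matrix

variable {Y : Type w} {k : Type u} [CommRing k]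

/-- The generating series `∑ₙ tⁿ Aⁿ` of the powers of a matrix. -/
noncomputable def matrixGeomSeries [Fintype Y] [DecidableEq Y] (A : Matrix Y Y k) :
    Matrix Y Y (PowerSeries k) :=
  .of fun a b => .mk fun n => (A ^ n) a b

/-- The matrix `1 - t A`, whose determinant is `Matrix.charpolyRev A`. -/
noncomputable def charmatrixRev [DecidableEq Y] (A : Matrix Y Y k) : Matrix Y Y (Polynomial k) :=
  1 - (Polynomial.X : Polynomial k) • A.map Polynomial.C

lemma map_eval_charmatrixRev [DecidableEq Y] (A : Matrix Y Y k) (a : k) :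
    (charmatrixRev A).map (Polynomial.evalRingHom a) = 1 - a • A := by
  ext x y
  by_cases h : x = y <;> simp [charmatrixRev, h, -Polynomial.X_mul_C]

lemma map_coe_charmatrixRev [DecidableEq Y] (A : Matrix Y Y k) :
    (charmatrixRev A).map Polynomial.coeToPowerSeries.ringHom =
      1 - (PowerSeries.X : PowerSeries k) • A.map PowerSeries.C := by
  ext1 x y
  by_cases h : x = y <;> simp [charmatrixRev, h, -Polynomial.X_mul_C]

variable [Fintype Y] [DecidableEq Y] (A : Matrix Y Y k)

lemma one_sub_X_smul_mul_matrixGeomSeries :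
    (1 - (PowerSeries.X : PowerSeries k) • A.map PowerSeries.C) * matrixGeomSeries A = 1 := by
  have hA : (A.map PowerSeries.C : Matrix Y Y (PowerSeries k)) * matrixGeomSeries A =
      .of fun a b => .mk fun n => (A ^ (n + 1)) a b := by
    ext a b n
    simp [matrixGeomSeries, Matrix.mul_apply, pow_succ']
  rw [sub_mul, one_mul, Matrix.smul_mul, hA]
  ext a b n
  cases n with
  | zero => by_cases h : a = b <;> simp [matrixGeomSeries, h, Matrix.one_apply]
  | succ n =>
    by_cases h : a = b <;> simp [matrixGeomSeries, h, Matrix.one_apply,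
      PowerSeries.coeff_succ_X_mul, PowerSeries.coeff_one]

lemma charpolyRev_smul_matrixGeomSeries :
    (A.charpolyRev : PowerSeries k) • matrixGeomSeries A =
      (charmatrixRev A).adjugate.map Polynomial.coeToPowerSeries.ringHom := by
  let φ : Polynomial k →+* PowerSeries k := Polynomial.coeToPowerSeries.ringHom
  have hdet : (φ.mapMatrix (charmatrixRev A)).det = A.charpolyRev :=
    (φ.map_det (charmatrixRev A)).symm
  have hmul : φ.mapMatrix (charmatrixRev A) * matrixGeomSeries A = 1 := by
    rw [RingHom.mapMatrix_apply, map_coe_charmatrixRev, one_sub_X_smul_mul_matrixGeomSeries]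
  calc (A.charpolyRev : PowerSeries k) • matrixGeomSeries A
      = (φ.mapMatrix (charmatrixRev A)).adjugate * (φ.mapMatrix (charmatrixRev A) *
          matrixGeomSeries A) := by
        rw [← mul_assoc, adjugate_mul, hdet, Matrix.smul_mul, one_mul]
    _ = (φ.mapMatrix (charmatrixRev A)).adjugate := by rw [hmul, mul_one]
    _ = (charmatrixRev A).adjugate.map φ := (φ.map_adjugate _).symm

lemma eval_charpolyRev_eq_det (a : k) : A.charpolyRev.eval a = (1 - a • A).det := by
  rw [← map_eval_charmatrixRev, ← RingHom.mapMatrix_apply, ← RingHom.map_det]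
  rfl

lemma eval_charpolyRev_smul_inv {a : k} (ha : IsUnit (1 - a • A)) :
    A.charpolyRev.eval a • (1 - a • A)⁻¹ =
      (charmatrixRev A).adjugate.map (Polynomial.evalRingHom a) := by
  rw [eval_charpolyRev_eq_det, Matrix.inv_def, smul_smul,
    Ring.mul_inverse_cancel _ ((Matrix.isUnit_iff_isUnit_det _).1 ha), one_smul,
    ← map_eval_charmatrixRev]
  exact ((Polynomial.evalRingHom a).map_adjugate (charmatrixRev A)).symm

/-- By Cramer's rule, the geometric series of `A` has denominator `det (1 - t A)`. -/
theorem isRationalWithValue_trace_pow_mul (M : Matrix Y Y k) {a : k} (ha : IsUnit (1 - a • A)) :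
    IsRationalWithValue (.mk fun n => (A ^ n * M).trace) a ((1 - a • A)⁻¹ * M).trace := by
  have hseries : (PowerSeries.mk fun n => (A ^ n * M).trace) =
      (matrixGeomSeries A * M.map PowerSeries.C).trace := by
    ext n
    simp [matrixGeomSeries, Matrix.trace, Matrix.mul_apply]
  have hcoe : (M.map Polynomial.C).map Polynomial.coeToPowerSeries.ringHom =
      M.map PowerSeries.C := by
    ext1
    simp
  have heval : (M.map Polynomial.C).map (Polynomial.evalRingHom a) = M := by
    ext1
    simp
  refine ⟨((charmatrixRev A).adjugate * M.map Polynomial.C).trace, A.charpolyRev, ?_, ?_, ?_, ?_⟩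
  · rw [PowerSeries.isUnit_iff_constantCoeff, Polynomial.constantCoeff_coe,
      Polynomial.coeff_zero_eq_eval_zero, Matrix.eval_charpolyRev]
    exact isUnit_one
  · rw [hseries, ← smul_eq_mul, ← Matrix.trace_smul, ← Matrix.smul_mul,
      charpolyRev_smul_matrixGeomSeries, ← hcoe, ← Matrix.map_mul]
    exact (AddMonoidHom.map_trace Polynomial.coeToPowerSeries.ringHom _).symm
  · rw [eval_charpolyRev_eq_det]
    exact (Matrix.isUnit_iff_isUnit_det _).1 ha
  · rw [← smul_eq_mul, ← Matrix.trace_smul, ← Matrix.smul_mul, eval_charpolyRev_smul_inv A ha]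
    nth_rw 1 [← heval]
    rw [← Matrix.map_mul]
    exact (AddMonoidHom.map_trace (Polynomial.evalRingHom a) _).symm

end GeometricSeries

section BarConstruction

variable {W : Type u₂} [Category.{v₂} W] [MonoidalCategory W] {Y : Type w} [EnrichedCategory W Y]
  (M : EnrichedBimodule W Y) (x₀ : Y)

/-- The latching map at `x :: x :: l` is the pushout product of the identity of `x` with the
latching map at `x :: l`. -/
noncomputable def pushoutProductEIdLatchingMap [HasFiniteColimits W] (x : Y) (l : List Y)
    [PreservesFiniteColimits (tensorLeft (x ⟶[W] x))] :
    (curriedTensor W).PushoutObjObj (eId W x) (latchingMap M x₀ x l) where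
  pt := latchingObject M x₀ x (x :: l)
  inl := latchingKeep M x₀ x x l
  inr := (λ_ _).hom ≫ latchingDup M x₀ x l
  isPushout := (isPushout_latchingKeep_latchingDup M x₀ x l).of_iso (λ_ _).symm (Iso.refl _)
    (λ_ _).symm (Iso.refl _) (by simp [insertUnit]) (leftUnitor_inv_naturality _) (by simp)
    (by simp)
  ι := latchingMap M x₀ x (x :: l)
  inl_ι := latchingKeep_latchingMap M x₀
  inr_ι := (Category.assoc _ _ _).trans <|
    (congrArg ((λ_ _).hom ≫ ·) (latchingDup_latchingMap M x₀)).trans (Iso.hom_inv_id_assoc _ _)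

variable {M} [ModelCategory W] [IsMonoidalModelCategory W]
  [∀ A : W, PreservesFiniteColimits (tensorLeft A)]
  [∀ A : W, PreservesColimitsOfShape (Discrete PEmpty.{1}) (tensorRight A)]
  {k : Type u} [CommRing k] {χ : EulerCharacteristic W k} [DecidableEq Y]

theorem hasRelativeChi_latchingMap (hχ : χ.IsMultiplicative) (hY : IsCofibrantEnriched W Y)
    (hYfin : ∀ x y : Y, χ.IsFinite (x ⟶[W] y)) (hM : ∀ x, IsCofibrant (M.obj x x₀))
    (hMfin : ∀ x, χ.IsFinite (M.obj x x₀)) (x : Y) (l : List Y) :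
    χ.HasRelativeChi (latchingMap M x₀ x l)
      (pathWeight (zetaMatrix χ.chi Y - 1) (fun y => χ.chi (M.obj y x₀)) x l) := by
  induction l generalizing x with
  | nil =>
    exact EulerCharacteristic.hasRelativeChi_of_isInitial (hB := hM x) _
      (isInitialLatchingObjectNil M x₀ x) (hMfin x)
  | cons y l ih =>
    by_cases hxy : x = y
    · subst hxy
      have hId := EulerCharacteristic.hasRelativeChi_eId hχ x (hY.2 x) (hYfin x x)
      have hprod := hId.pushoutProduct hχ (ih x) (pushoutProductEIdLatchingMap M x₀ x l)
      rw [pathWeight, Matrix.sub_apply, Matrix.one_apply_eq]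
      exact hprod
    · have hHom := EulerCharacteristic.hasRelativeChi_of_isInitial (hB := hY.1 x y)
        (initial.to (x ⟶[W] y)) initialIsInitial (hYfin x y)
      have := isIso_latchingKeep M x₀ hxy l
      have hprod := hHom.pushoutProduct hχ (ih y) (pushoutProductInitialTo _ (latchingMap M x₀ y l)
        (latchingKeep M x₀ x y l) (latchingMap M x₀ x (y :: l)) (latchingKeep_latchingMap M x₀))
      rw [pathWeight, Matrix.sub_apply, Matrix.one_apply_ne hxy, sub_zero]
      exact hprod

end BarConstruction

section Magnitude

lemma trace_zetaMatrix_inv_mul_one {V : Type u₁} [Category.{v₁} V] [MonoidalCategory V]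
    {k : Type u} [CommRing k] (size : V → k) (X : Type w) [EnrichedCategory V X] [Fintype X]
    [DecidableEq X] :
    ((zetaMatrix size X)⁻¹ * Matrix.of fun _ _ => 1).trace = magnitude size X := by
  simp [Matrix.trace, Matrix.mul_apply, magnitude]

variable {W : Type u₂} [Category.{v₂} W] [MonoidalCategory W] [ModelCategory W]
  [IsMonoidalModelCategory W] [∀ A : W, PreservesFiniteColimits (tensorLeft A)]
  [∀ A : W, PreservesColimitsOfShape (Discrete PEmpty.{1}) (tensorRight A)]
  {k : Type u} [CommRing k] {χ : EulerCharacteristic W k}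

theorem isRationalWithValue_sum_chi_barTerm_sub_chi_latchingTerm {Y : Type w} [Fintype Y]
    [DecidableEq Y] [EnrichedCategory W Y] (M : EnrichedBimodule W Y) (hχ : χ.IsMultiplicative)
    (hY : IsCofibrantEnriched W Y) (hYfin : ∀ x y : Y, χ.IsFinite (x ⟶[W] y))
    (hM : ∀ x y, IsCofibrant (M.obj x y)) (hMfin : ∀ x y, χ.IsFinite (M.obj x y))
    (hZ : HasMobiusInversion χ.chi Y) :
    IsRationalWithValue
      (.mk fun n => ∑ x : Fin (n + 1) → Y, (χ.chi (barTerm M x) - χ.chi (latchingTerm M x))) (-1)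
      ((zetaMatrix χ.chi Y)⁻¹ * Matrix.of fun x y => χ.chi (M.obj x y)).trace := by
  have hinv : 1 - (-1 : k) • (zetaMatrix χ.chi Y - 1) = zetaMatrix χ.chi Y := by
    rw [neg_one_smul, sub_neg_eq_add, add_sub_cancel]
  have hweight {n : ℕ} (x : Fin (n + 1) → Y) :=
    (hasRelativeChi_latchingMap (x 0) hχ hY hYfin (fun y => hM y _) (fun y => hMfin y _) (x 0)
      (List.ofFn fun i : Fin n => x i.succ)).chi_sub_chi
  have hseries (n : ℕ) :=
    (Finset.sum_congr rfl fun x _ => hweight x).trans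
      (sum_pathWeight_eq_trace (zetaMatrix χ.chi Y - 1) (.of fun x y => χ.chi (M.obj x y)) n)
  simp only [barTerm, latchingTerm, hseries]
  have hrat := isRationalWithValue_trace_pow_mul (a := -1) (zetaMatrix χ.chi Y - 1)
    (.of fun x y => χ.chi (M.obj x y)) (by rwa [hinv])
  rwa [hinv] at hrat

variable {V : Type u₁} [Category.{v₁} V] [SemiCartesianMonoidalCategory V]

theorem mainTheorem9_general (hχ : χ.IsMultiplicative) (S : V ⥤ W) [S.Monoidal] (X : Type w)
    [Fintype X] [DecidableEq X] [EnrichedCategory V X]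
    (hS : ∀ x y : X, χ.IsFinite (S.obj (x ⟶[V] y)))
    (hX : IsCofibrantEnriched W (TransportEnrichment S X))
    (hM : HasMobiusInversion (χ.size S) X) :
    (∀ (n : ℕ) (x : Fin (n + 1) → X),
      χ.IsFinite (barTerm (unitBimodule S X) x) ∧
        χ.IsFinite (latchingTerm (unitBimodule S X) x)) ∧
    IsRationalWithValue (wgtSeries χ S X) (-1) (magnitude (χ.size S) X) := by
  let e : 𝟙_ W ≅ S.obj (𝟙_ V) := Functor.Monoidal.εIso S
  have : IsCofibrant (𝟙_ W) := IsMonoidalModelCategory.isCofibrant_unit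
  have hcof : IsCofibrant (S.obj (𝟙_ V)) := isCofibrant_of_cofibration e.hom
  have hfin : χ.IsFinite (S.obj (𝟙_ V)) := (χ.isFinite_iff_of_iso e).1 hχ.isFinite_unit
  have hchi : χ.chi (S.obj (𝟙_ V)) = 1 :=
    (χ.chi_eq_of_iso e hχ.isFinite_unit).symm.trans hχ.chi_unit
  let _ : Fintype (TransportEnrichment S X) := inferInstanceAs (Fintype X)
  let _ : DecidableEq (TransportEnrichment S X) := inferInstanceAs (DecidableEq X)
  refine ⟨fun n x => ?_, ?_⟩
  · have h := hasRelativeChi_latchingMap (M := unitBimodule S X) (x 0) hχ hX hS (fun _ => hcof)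
      (fun _ => hfin) (x 0) (List.ofFn fun i : Fin n => x i.succ)
    exact ⟨h.isFinite_target, h.isFinite_source⟩
  · have h := isRationalWithValue_sum_chi_barTerm_sub_chi_latchingTerm (unitBimodule S X) hχ hX hS
      (fun _ _ => hcof) (fun _ _ => hfin) hM
    simp only [unitBimodule, hchi] at h
    rw [← trace_zetaMatrix_inv_mul_one]
    exact h

end Magnitude

theorem mainTheorem9
    {V : Type u₁} [Category.{v₁} V] [SemiCartesianMonoidalCategory V]
    {W : Type u₂} [Category.{v₂} W] [MonoidalCategory W] [SymmetricCategory W] [MonoidalClosed W]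
    [ModelCategory W] [IsMonoidalModelCategory W]
    {k : Type u} [CommRing k]
    (χ : EulerCharacteristic W k) (hχ : χ.IsMultiplicative)
    (S : V ⥤ W) [S.Monoidal] (hS : ∀ a : V, χ.IsFinite (S.obj a))
    (X : Type w) [Fintype X] [DecidableEq X] [EnrichedCategory V X]
    (hX : IsCofibrantEnriched W (TransportEnrichment S X))
    (hM : HasMobiusInversion (χ.size S) X) :
    (∀ (n : ℕ) (x : Fin (n + 1) → X),
      χ.IsFinite (barTerm (unitBimodule S X) x) ∧
        χ.IsFinite (latchingTerm (unitBimodule S X) x)) ∧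
    IsRationalWithValue (wgtSeries χ S X) (-1) (magnitude (χ.size S) X) :=
  mainTheorem9_general hχ S X (fun _ _ => hS _) hX hM
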